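/- Let $N_C, N_R, N_I, N_S$ be disjoint countably infinite sets of concept names (with a distinguished name $\top$), role names, individuals and shape names. A role is $p$ or $p^-$ with $p \in N_R$. A data graph $\mathcal G$ is a (finite or infinite) set of atoms $A(a)$, $p(a,b)$ with $A\in N_C$, $p\in N_R$, $a,b\in N_I$. Let $\Delta^{\mathcal G}$ be the set of individuals that appear in $\mathcal G$, and put $A^{\mathcal G}=\{a \mid A(a)\in\mathcal G\}$ for $A\neq\top$, $\top^{\mathcal G}=\Delta^{\mathcal G}$, $p^{\mathcal G}=\{(a,b)\mid p(a,b)\in\mathcal G\}$, $(p^-)^{\mathcal G}=\{(b,a)\mid p(a,b)\in\mathcal G\}$. The shape expressions of $\mathcal{ALCIO}$ SHACL are given by $$\varphi ::= s \mid a \mid A \mid \lnot s \mid \varphi\land\varphi \mid \varphi\lor\varphi \mid \forall r.\varphi \mid \exists r.\varphi$$ with $s\in N_S$, $a\in N_I$, $A\in N_C$ and $r$ a role. A constraint has the form $s\leftarrow\varphi$; a constraint set is a finite set $\mathcal C$ of constraints in which every shape name is the head of at most one constraint. For sets $X,S$ of shape atoms $s(a)$ ($s\in N_S$, $a\in N_I$),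 let $[\varphi]^{\mathcal G}_{X,S}$ be the set of nodes at which $\varphi$ holds when shape names are read in $X$ and negated shape names in $S$: $[s]=\{a\mid s(a)\in X\}$, $[\lnot s]=\{a\in\Delta^{\mathcal G}\mid s(a)\notin S\}$, $[a]=\{a\}$, $[A]=A^{\mathcal G}$, conjunction and disjunction are intersection and union, $[\forall r.\varphi]=\{a\in\Delta^{\mathcal G}\mid b\in[\varphi]\text{ for all } b \text{ with } (a,b)\in r^{\mathcal G}\}$, and $[\exists r.\varphi]=\{a\mid b\in[\varphi]\text{ for some } b \text{ with } (a,b)\in r^{\mathcal G}\}$. A set $S$ of shape atoms is a stable model of $\mathcal G$ and $\mathcal C$ if $S$ is the least set $X$ such that $s(a)\in X$ whenever $s\leftarrow\varphi\in\mathcal C$ and $a\in[\varphi]^{\mathcal G}_{X,S}$. A node $a$ of $\mathcal G$ satisfies $(\mathcal C,s)$ under the stable model semantics if $s(a)\in S$ for some stable model $S$ of $\mathcal G$ and $\mathcal C$. Shape implication with respect to constraints under the stable model semantics is the following problem: given constraint sets $\mathcal C_1,\mathcal C_2$ and shape names $s_1,s_2$, decide whether, in every data graph $\mathcal G$ in which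 all individuals mentioned in $\mathcal C_1$ and $\mathcal C_2$ appear, every node that satisfies $(\mathcal C_1,s_1)$ also satisfies $(\mathcal C_2,s_2)$. **Theorem.** Under the stable model semantics, shape implication with respect to constraints is undecidable for $\mathcal{ALCIO}$ SHACL. -/

import Mathlib

namespace SHACL

/-! ## Data graphs -/

/-- The four kinds of names are countably infinite; disjointness is enforced by the syntax, where
each kind of name is used only under its own constructors. -/
abbrev ConceptName := ℕ
/-- Role names. -/
abbrev RoleName := ℕ
/-- Individuals. -/
abbrev Individual := ℕ
/-- Shape names. -/
abbrev ShapeName := ℕ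

/-- The distinguished concept name `⊤`. -/
def topConcept : ConceptName := 0

/-- A role is a role name `p` or its inverse `p⁻`. -/
inductive Role where
  | name (p : RoleName)
  | inv (p : RoleName)

/-- Assertions `A(a)` and `p(a, b)`. -/
inductive Atom where
  | concept (A : ConceptName) (a : Individual)
  | role (p : RoleName) (a b : Individual)

/-- A data graph is a set of atoms, finite or infinite. -/
abbrev DataGraph := Set Atom

namespace DataGraph

/-- `Δ^G`: the individuals that appear in `G`. -/
def nodes (G : DataGraph) : Set Individual :=
  {a | (∃ A, Atom.concept A a ∈ G) ∨ (∃ p b, Atom.role p a b ∈ G) ∨ (∃ p b, Atom.role p b a ∈ G)}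

/-- `A^G`; the name `⊤` holds at every node of `G`. -/
def conceptExt (G : DataGraph) (A : ConceptName) : Set Individual :=
  {a | Atom.concept A a ∈ G ∨ (A = topConcept ∧ a ∈ G.nodes)}

/-- `r^G`, as a relation between individuals. -/
def roleExt (G : DataGraph) : Role → Individual → Individual → Prop
  | Role.name p, a, b => Atom.role p a b ∈ G
  | Role.inv p, a, b => Atom.role p b a ∈ G

end DataGraph

/-! ## Syntax of ALCIO SHACL -/

/-- Shape expressions
`φ ::= s | a | A | ¬s | φ ∧ φ | φ ∨ φ | ∀r.φ | ∃r.φ`. -/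
inductive ShapeExpr where
  | shape (s : ShapeName)
  | nominal (a : Individual)
  | concept (A : ConceptName)
  | negShape (s : ShapeName)
  | and (φ ψ : ShapeExpr)
  | or (φ ψ : ShapeExpr)
  | all (r : Role) (φ : ShapeExpr)
  | ex (r : Role) (φ : ShapeExpr)

/-- The individuals that appear in a shape expression. -/
def ShapeExpr.individuals : ShapeExpr → Set Individual
  | .shape _ => ∅
  | .nominal a => {a}
  | .concept _ => ∅
  | .negShape _ => ∅
  | .and φ ψ => φ.individuals ∪ ψ.individuals
  | .or φ ψ => φ.individuals ∪ ψ.individuals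
  | .all _ φ => φ.individuals
  | .ex _ φ => φ.individuals

/-- A constraint `s ← φ` is the pair `(s, φ)`. -/
abbrev Constraint := ShapeName × ShapeExpr

/-- Finite collections of constraints, as they are given to an algorithm. -/
abbrev Constraints := List Constraint

/-- Each shape name is the head of at most one constraint. -/
def Constraints.UniqueHeads (C : Constraints) : Prop := (C.map Prod.fst).Nodup

/-- What a target may select: an individual, the instances of a concept name, or the domain of a
role. -/
inductive TargetSelector where
  | individual (a : Individual)
  | concept (A : ConceptName)
  | role (r : Role)

/-- A target `(ℓ, s)`. -/
abbrev Target := TargetSelector × ShapeName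

/-- A SHACL document `(C, T)`. -/
structure Document where
  constraints : Constraints
  targets : Set Target

/-- The individuals that appear in a document. -/
def Document.individuals (D : Document) : Set Individual :=
  {a | (∃ c ∈ D.constraints, a ∈ c.2.individuals) ∨
    (∃ s, (TargetSelector.individual a, s) ∈ D.targets)}

/-- `G` is compatible with `D` if every individual that appears in `D` also appears in `G`. -/
def Compatible (G : DataGraph) (D : Document) : Prop := D.individuals ⊆ G.nodes

/-! ## Semantics -/

/-- A shape atom `s(a)` is the pair `(s, a)`. -/
abbrev ShapeAtom := ShapeName × Individual

/-- A total shape assignment for a graph `G`, given by the shape atoms that it makes true: `s(a)`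
is validated if it is in the set, and `¬s(a)` holds at the other nodes `a` of `G`. -/
abbrev Assignment := Set ShapeAtom

/-- The nodes of `G` at which a shape expression holds, where the shape names `s` are read in the
assignment `X` and the negated shape names `¬s` in the assignment `S`. The value of `φ` under one
total assignment `S` is `eval G S S φ`. -/
def eval (G : DataGraph) (X S : Assignment) : ShapeExpr → Set Individual
  | .shape s => {a | (s, a) ∈ X}
  | .nominal a => {a}
  | .concept A => G.conceptExt A
  | .negShape s => {a | a ∈ G.nodes ∧ (s, a) ∉ S}
  | .and φ ψ => eval G X S φ ∩ eval G X S ψ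
  | .or φ ψ => eval G X S φ ∪ eval G X S ψ
  | .all r φ => {a | a ∈ G.nodes ∧ ∀ b ∈ G.nodes, G.roleExt r a b → b ∈ eval G X S φ}
  | .ex r φ => {a | ∃ b, G.roleExt r a b ∧ b ∈ eval G X S φ}

/-- A semantics maps a graph and a set of constraints to a set of assignments. -/
abbrev Semantics := DataGraph → Constraints → Set Assignment

/-- `X` is closed under the reduct of the constraints `C` with respect to `S`: the negated shape
names are evaluated in the fixed assignment `S`, everything else in `X`. -/
def ClosedUnderReduct (G : DataGraph) (C : Constraints) (S X : Assignment) : Prop :=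
  ∀ c ∈ C, ∀ a ∈ eval G X S c.2, (c.1, a) ∈ X

/-- The stable model semantics: `S` is a stable model of `G` and `C` if it is the least assignment
closed under the reduct of `C` with respect to `S` itself. -/
def stableSemantics : Semantics :=
  fun G C => {S | IsLeast {X : Assignment | ClosedUnderReduct G C S X} S}

/-- `G` validates the targets `T` under the assignment `S`. -/
def Validates (G : DataGraph) (T : Set Target) (S : Assignment) : Prop :=
  (∀ a s, (TargetSelector.individual a, s) ∈ T → (s, a) ∈ S) ∧
  (∀ A s, (TargetSelector.concept A, s) ∈ T → ∀ a ∈ G.conceptExt A, (s, a) ∈ S) ∧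
  (∀ r s, (TargetSelector.role r, s) ∈ T → ∀ a b, G.roleExt r a b → (s, a) ∈ S)

/-- `G` satisfies the document `D` under the semantics `Sem` (brave validation). -/
def Satisfies (Sem : Semantics) (G : DataGraph) (D : Document) : Prop :=
  ∃ S ∈ Sem G D.constraints, Validates G D.targets S

/-- The document `(C, s(a))`. -/
def nodeDocument (C : Constraints) (s : ShapeName) (a : Individual) : Document :=
  ⟨C, {(TargetSelector.individual a, s)}⟩

/-- `(C₁, s₁)` implies `(C₂, s₂)` under `Sem`: every node that satisfies `s₁` with respect to `C₁`
in a graph also satisfies `s₂` with respect to `C₂`. The graphs range over those that are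
compatible with both documents. -/
def ShapeImplies (Sem : Semantics) (C₁ : Constraints) (s₁ : ShapeName)
    (C₂ : Constraints) (s₂ : ShapeName) : Prop :=
  ∀ (G : DataGraph), ∀ a ∈ G.nodes,
    Compatible G (nodeDocument C₁ s₁ a) → Compatible G (nodeDocument C₂ s₂ a) →
    Satisfies Sem G (nodeDocument C₁ s₁ a) → Satisfies Sem G (nodeDocument C₂ s₂ a)

/-! ## Effective coding of the syntax

Shape expressions are coded as natural numbers by an explicit bijection, so that Mathlib's
computability predicates apply to finite collections of constraints. -/

/-- Roles are coded by parity. -/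
def Role.toNat : Role → ℕ
  | .name p => 2 * p
  | .inv p => 2 * p + 1

/-- Inverse of `Role.toNat`. -/
def Role.ofNat (n : ℕ) : Role :=
  if n % 2 = 0 then .name (n / 2) else .inv (n / 2)

theorem Role.ofNat_toNat (r : Role) : Role.ofNat r.toNat = r := by
  cases r with
  | name p => simp [Role.ofNat, Role.toNat]
  | inv p =>
    have h : ∀ n : ℕ, (2 * n + 1) % 2 = 1 ∧ (2 * n + 1) / 2 = n := fun n => by omega
    simp only [Role.ofNat, Role.toNat, (h p).1, (h p).2, one_ne_zero, if_false]

theorem Role.toNat_ofNat (n : ℕ) : (Role.ofNat n).toNat = n := by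
  unfold Role.ofNat
  split <;> simp only [Role.toNat] <;> omega

/-- The code of a shape expression: the top constructor is the remainder modulo `8`. -/
def ShapeExpr.toNat : ShapeExpr → ℕ
  | .shape s => 8 * s
  | .nominal a => 8 * a + 1
  | .concept A => 8 * A + 2
  | .negShape s => 8 * s + 3
  | .and φ ψ => 8 * Nat.pair φ.toNat ψ.toNat + 4
  | .or φ ψ => 8 * Nat.pair φ.toNat ψ.toNat + 5
  | .all r φ => 8 * Nat.pair r.toNat φ.toNat + 6
  | .ex r φ => 8 * Nat.pair r.toNat φ.toNat + 7

/-- Inverse of `ShapeExpr.toNat`. -/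
def ShapeExpr.ofNat (n : ℕ) : ShapeExpr :=
  if n % 8 = 0 then .shape (n / 8)
  else if n % 8 = 1 then .nominal (n / 8)
  else if n % 8 = 2 then .concept (n / 8)
  else if n % 8 = 3 then .negShape (n / 8)
  else if n % 8 = 4 then
    .and (ShapeExpr.ofNat (n / 8).unpair.1) (ShapeExpr.ofNat (n / 8).unpair.2)
  else if n % 8 = 5 then
    .or (ShapeExpr.ofNat (n / 8).unpair.1) (ShapeExpr.ofNat (n / 8).unpair.2)
  else if n % 8 = 6 then
    .all (Role.ofNat (n / 8).unpair.1) (ShapeExpr.ofNat (n / 8).unpair.2)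
  else
    .ex (Role.ofNat (n / 8).unpair.1) (ShapeExpr.ofNat (n / 8).unpair.2)
termination_by n
decreasing_by
  all_goals
    have h₁ := Nat.unpair_left_le (n / 8)
    have h₂ := Nat.unpair_right_le (n / 8)
    omega

theorem ShapeExpr.ofNat_toNat (φ : ShapeExpr) : ShapeExpr.ofNat φ.toNat = φ := by
  induction φ <;> rw [ShapeExpr.ofNat] <;>
    simp_all [ShapeExpr.toNat, Nat.add_mod, Nat.add_div, Role.ofNat_toNat]

theorem ShapeExpr.toNat_ofNat (n : ℕ) : (ShapeExpr.ofNat n).toNat = n := by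
  induction n using Nat.strong_induction_on with
  | _ n ih =>
    have h₁ := Nat.unpair_left_le (n / 8)
    have h₂ := Nat.unpair_right_le (n / 8)
    rw [ShapeExpr.ofNat]
    split_ifs
    all_goals simp only [ShapeExpr.toNat]
    all_goals try rw [ih _ (by omega)]
    all_goals try rw [ih _ (by omega)]
    all_goals try rw [Role.toNat_ofNat]
    all_goals try rw [Nat.pair_unpair]
    all_goals omega

/-- Shape expressions are in explicit bijection with the natural numbers. -/
def ShapeExpr.equivNat : ShapeExpr ≃ ℕ where
  toFun := ShapeExpr.toNat
  invFun := ShapeExpr.ofNat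
  left_inv := ShapeExpr.ofNat_toNat
  right_inv := ShapeExpr.toNat_ofNat

instance : Denumerable ShapeExpr := Denumerable.mk' ShapeExpr.equivNat

/-- An instance of shape implication: the pairs `(C₁, s₁)` and `(C₂, s₂)`. -/
abbrev ImplicationInstance := (Constraints × ShapeName) × (Constraints × ShapeName)

/-- Shape implication with respect to constraints is decidable under `Sem`: some algorithm answers
correctly on all pairs of constraint sets in which every shape name heads at most one constraint. -/
def ShapeImplicationDecidable (Sem : Semantics) : Prop :=
  ∃ decider : ImplicationInstance → Bool, Computable decider ∧
    ∀ (C₁ : Constraints) (s₁ : ShapeName) (C₂ : Constraints) (s₂ : ShapeName),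
      C₁.UniqueHeads → C₂.UniqueHeads →
      (decider ((C₁, s₁), (C₂, s₂)) = true ↔ ShapeImplies Sem C₁ s₁ C₂ s₂)

end SHACL

/-! The halting problem reduces to shape implication. Let the left side of the implication hold at
every node. Then the implication fails exactly when some node of some graph has its goal shape
refuted by all stable models. The constraints `0 ← ¬1` and `1 ← ¬0` let a stable model choose an
arbitrary set of nodes, so refutation quantifies universally over sets. This quantifier gives
equality: two points coincide iff no set contains the first and omits the second. Refuting the goal
can therefore force equations between paths of roles, although the language has neither equality nor
number restrictions.

Such equations, some of them conditional on a zero test, axiomatize a primitive recursive function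
`F` by unary functions on tuples: projections, predecessor, and auxiliary functions that form tuples
(`captured_of_primrec'`). Nonstandard points may exist. They do no harm, since only the values at
points that represent numbers matter.

The least fixed point of shape `5` searches for `k` with `F (k, n) = 0`. If such a `k` exists, a
refuting node would yield a model of the equations in which the search must succeed, a contradiction
(`exists_model_of_not_goal`). If none exists, the graph of the standard functions on lists refutes
the goal at `[0, n]` (`not_goal_standardGraph`). With `F` a bounded halting test, a decision
procedure for implication would decide halting. -/

namespace SHACL

/-! ## Clauses over unary function symbols -/

/-- The tests that may be applied at the end of a path: membership in a set variable, membership in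
a distinguished set of zeros, and their negations. -/
inductive Label where
  | mem
  | notMem
  | zero
  | nonzero

/-- Truth of a label at a point, where `X` is the value of the set variable and `Z` the set of
zeros. -/
def Label.Holds {W : Type} (X Z : Set W) : Label → W → Prop
  | .mem, x => x ∈ X
  | .notMem, x => x ∉ X
  | .zero, x => x ∈ Z
  | .nonzero, x => x ∉ Z

/-- A clause is a conjunction of labels at the ends of paths of unary function symbols. -/
abbrev Clause (σ : Type) := List (List σ × Label)

/-- The end of the path from `x` that follows the symbols in order. -/
def pathEnd {σ W : Type} (ι : σ → W → W) (p : List σ) (x : W) : W :=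
  p.foldl (fun y f => ι f y) x

/-- The clause holds at `x`. -/
def Clause.Holds {σ W : Type} (ι : σ → W → W) (X Z : Set W) (c : Clause σ) (x : W) : Prop :=
  ∀ l ∈ c, l.2.Holds X Z (pathEnd ι l.1 x)

/-- No clause of `T` holds anywhere, whatever the value of the set variable. -/
def Avoids {σ W : Type} (ι : σ → W → W) (Z : Set W) (T : List (Clause σ)) : Prop :=
  ∀ c ∈ T, ∀ x X, ¬ Clause.Holds ι X Z c x

/-! ### Equations and conditional equations as avoided clauses -/

section Avoids

variable {σ W : Type} {ι : σ → W → W} {Z : Set W}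

theorem avoids_nil : Avoids ι Z [] := by simp [Avoids]

theorem avoids_cons {c : Clause σ} {T : List (Clause σ)} :
    Avoids ι Z (c :: T) ↔ (∀ x X, ¬ c.Holds ι X Z x) ∧ Avoids ι Z T := by
  simp [Avoids]

theorem avoids_append {T U : List (Clause σ)} :
    Avoids ι Z (T ++ U) ↔ Avoids ι Z T ∧ Avoids ι Z U := by
  simp [Avoids, or_imp, forall_and]

theorem avoids_flatMap {α : Type} {l : List α} {T : α → List (Clause σ)} :
    Avoids ι Z (l.flatMap T) ↔ ∀ i ∈ l, Avoids ι Z (T i) := by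
  simp only [Avoids, List.mem_flatMap]
  exact ⟨fun h i hi c hc => h c ⟨i, hi, hc⟩, fun h c ⟨i, hi, hc⟩ => h i hi c hc⟩

theorem avoids_map {α : Type} {l : List α} {T : α → Clause σ} :
    Avoids ι Z (l.map T) ↔ ∀ i ∈ l, ∀ x X, ¬ (T i).Holds ι X Z x := by
  simp [Avoids]

/-- The clause that refutes the equation `p = q` between paths. -/
def eqClause (p q : List σ) : Clause σ := [(p, .mem), (q, .notMem)]

/-- Leibniz equality: the singleton of the first end point separates it from every other point. -/
theorem not_holds_eqClause {p q : List σ} {x : W} :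
    (∀ X, ¬ (eqClause p q).Holds ι X Z x) ↔ pathEnd ι p x = pathEnd ι q x := by
  simp only [Clause.Holds, eqClause, List.forall_mem_cons, Label.Holds]
  refine ⟨fun h => ?_, fun h X => by simp [h]⟩
  have := h {pathEnd ι p x}
  simpa [eq_comm] using this

/-- The clause that refutes the equation `p = q` under the condition `l`. -/
def condEqClause (l : List σ × Label) (p q : List σ) : Clause σ := l :: eqClause p q

theorem not_holds_condEqClause_zero {r p q : List σ} {x : W} :
    (∀ X, ¬ (condEqClause (r, .zero) p q).Holds ι X Z x) ↔
      (pathEnd ι r x ∈ Z → pathEnd ι p x = pathEnd ι q x) := by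
  rw [← not_holds_eqClause (ι := ι) (Z := Z)]
  simp only [Clause.Holds, condEqClause, List.forall_mem_cons, Label.Holds]
  tauto

theorem not_holds_condEqClause_nonzero {r p q : List σ} {x : W} :
    (∀ X, ¬ (condEqClause (r, .nonzero) p q).Holds ι X Z x) ↔
      (pathEnd ι r x ∉ Z → pathEnd ι p x = pathEnd ι q x) := by
  rw [← not_holds_eqClause (ι := ι) (Z := Z)]
  simp only [Clause.Holds, condEqClause, List.forall_mem_cons, Label.Holds]
  tauto

theorem not_holds_zero {p : List σ} {x : W} :
    (∀ X, ¬ Clause.Holds ι X Z [(p, .zero)] x) ↔ pathEnd ι p x ∉ Z := by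
  simp [Clause.Holds, Label.Holds]

theorem not_holds_nonzero {p : List σ} {x : W} :
    (∀ X, ¬ Clause.Holds ι X Z [(p, .nonzero)] x) ↔ pathEnd ι p x ∈ Z := by
  simp [Clause.Holds, Label.Holds]

theorem pathEnd_nil {x : W} : pathEnd ι [] x = x := rfl

theorem pathEnd_cons {f : σ} {p : List σ} {x : W} :
    pathEnd ι (f :: p) x = pathEnd ι p (ι f x) := rfl

end Avoids

/-! ## Primitive recursive functions as avoided clauses

The function symbols are functions on lists of numbers. A list stands for each vector of its initial
entries, padded with zeros, and a one-element list stands for a number. -/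

/-- Functions on lists of numbers, used as function symbols. -/
abbrev ListFun := List ℕ → List ℕ

/-- The lists that stand for zero. -/
def zeroLists : Set (List ℕ) := {x | x.getD 0 0 = 0}

/-- The `i`-th entry. -/
def entry (i : ℕ) : ListFun := fun x => [x.getD i 0]

/-- The predecessor of the first entry. -/
def predFun : ListFun := fun x => [x.getD 0 0 - 1]

/-- The vector of the first `n` entries. -/
def toVec (n : ℕ) (x : List ℕ) : List.Vector ℕ n := List.Vector.ofFn fun i => x.getD i 0

/-- A function on vectors as a function on lists. -/
def liftFun {n : ℕ} (f : List.Vector ℕ n → ℕ) : ListFun := fun x => [f (toVec n x)]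

section Represents

variable {W : Type} (ι : ListFun → W → W) (Z : Set W)

/-- `x` represents a number by its iterated predecessors. -/
def RepNat : ℕ → W → Prop
  | 0, x => x ∈ Z
  | k + 1, x => x ∉ Z ∧ RepNat k (ι predFun x)

/-- `x` represents a vector if its entries represent the entries of the vector. -/
def RepVec {n : ℕ} (v : List.Vector ℕ n) (x : W) : Prop :=
  ∀ i : Fin n, RepNat ι Z (v.get i) (ι (entry i) x)

end Represents

/-- Finitely many clauses, avoided by the standard interpretation, ensure that the symbol
`liftFun f` computes `f` on representations. -/
def Captured {n : ℕ} (f : List.Vector ℕ n → ℕ) : Prop :=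
  ∃ T : List (Clause ListFun), Avoids id zeroLists T ∧
    ∀ (W : Type) (ι : ListFun → W → W) (Z : Set W), Avoids ι Z T →
      ∀ v x, RepVec ι Z v x → RepNat ι Z (f v) (ι (liftFun f) x)

theorem captured_zero : Captured (n := 0) fun _ => 0 := by
  refine ⟨[[([liftFun (n := 0) fun _ => 0], .nonzero)]], ?_, ?_⟩
  · simp only [avoids_cons, avoids_nil, not_holds_nonzero, and_true]
    simp [pathEnd, liftFun, zeroLists]
  · intro W ι Z h v x _
    simp only [avoids_cons, avoids_nil, not_holds_nonzero, and_true] at h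
    exact h x

theorem captured_succ : Captured (n := 1) fun v => Nat.succ v.head := by
  set s := liftFun (n := 1) fun v => Nat.succ v.head with hs
  refine ⟨[eqClause [s, predFun] [entry 0], [([s], .zero)]], ?_, ?_⟩
  · simp only [avoids_cons, avoids_nil, not_holds_zero, not_holds_eqClause, and_true]
    simp [pathEnd, hs, liftFun, zeroLists, predFun, entry, toVec, List.Vector.head_ofFn]
  · intro W ι Z h v x hx
    simp only [avoids_cons, avoids_nil, not_holds_zero, not_holds_eqClause, and_true] at h
    refine ⟨h.2 x, ?_⟩
    have h1 : ι predFun (ι s x) = ι (entry 0) x := h.1 x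
    rw [h1]
    simpa using hx 0

/-- A symbol is the function itself, and a lifted projection is the same function on lists as `entry
i`. No clauses are needed. -/
theorem captured_get {n : ℕ} (i : Fin n) : Captured fun v : List.Vector ℕ n => v.get i := by
  refine ⟨[], avoids_nil, fun W ι Z _ v x hx => ?_⟩
  have : (liftFun fun v : List.Vector ℕ n => v.get i) = entry i := by
    funext x
    simp [liftFun, entry, toVec]
  rw [this]
  exact hx i

theorem toVec_ofFn {n : ℕ} (g : Fin n → ℕ) : toVec n (List.ofFn g) = List.Vector.ofFn g := by
  apply List.Vector.ext
  intro i
  simp [toVec]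

theorem captured_comp {m n : ℕ} {f : List.Vector ℕ n → ℕ} {g : Fin n → List.Vector ℕ m → ℕ}
    (hf : Captured f) (hg : ∀ i, Captured (g i)) :
    Captured fun a => f (List.Vector.ofFn fun i => g i a) := by
  obtain ⟨T, hT, hTf⟩ := hf
  choose U hU hUg using hg
  set h := liftFun fun a => f (List.Vector.ofFn fun i => g i a) with hh
  -- An auxiliary symbol forms the tuple of inner values, so that composition becomes the path `w`
  -- followed by `f`.
  let w : ListFun := fun x => List.ofFn fun i => g i (toVec m x)
  refine ⟨T ++ ((List.finRange n).flatMap U ++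
    ((List.finRange n).map (fun i : Fin n => eqClause [w, entry i] [liftFun (g i)]) ++
    [eqClause [w, liftFun f] [h]])), ?_, ?_⟩
  · simp only [avoids_append, avoids_flatMap, avoids_map, avoids_cons, avoids_nil,
      not_holds_eqClause, and_true]
    refine ⟨hT, fun i _ => hU i, fun i _ x => ?_, fun x => ?_⟩
    · simp [pathEnd, w, entry, liftFun]
    · simp [pathEnd, w, hh, liftFun, toVec_ofFn]
  · intro W ι Z H v x hx
    simp only [avoids_append, avoids_flatMap, avoids_map, avoids_cons, avoids_nil,
      not_holds_eqClause, and_true, pathEnd_cons, pathEnd_nil] at H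
    obtain ⟨H1, H2, H3, H4⟩ := H
    rw [← H4 x]
    apply hTf W ι Z H1
    intro i
    rw [H3 i (List.mem_finRange i) x, List.Vector.get_ofFn]
    exact hUg i W ι Z (H2 i (List.mem_finRange i)) v x hx

theorem repVec_cons {W : Type} {ι : ListFun → W → W} {Z : Set W} {n a : ℕ}
    {v : List.Vector ℕ n} {x : W} :
    RepVec ι Z (a ::ᵥ v) x ↔ RepNat ι Z a (ι (entry 0) x) ∧
      ∀ i : Fin n, RepNat ι Z (v.get i) (ι (entry (i + 1)) x) := by
  simp [RepVec, Fin.forall_fin_succ]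

theorem toVec_succ {n : ℕ} (x : List ℕ) : toVec (n + 1) x = x.getD 0 0 ::ᵥ toVec n x.tail := by
  apply List.Vector.ext
  intro i
  refine Fin.cases ?_ (fun j => ?_) i
  · simp [toVec]
  · simp [toVec]

theorem captured_prec {n : ℕ} {f : List.Vector ℕ n → ℕ} {g : List.Vector ℕ (n + 2) → ℕ}
    (hf : Captured f) (hg : Captured g) :
    Captured fun v : List.Vector ℕ (n + 1) =>
      v.head.rec (f v.tail) fun y IH => g (y ::ᵥ IH ::ᵥ v.tail) := by
  obtain ⟨T, hT, hTf⟩ := hf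
  obtain ⟨U, hU, hUg⟩ := hg
  set F : List.Vector ℕ (n + 1) → ℕ := fun v =>
    v.head.rec (f v.tail) fun y IH => g (y ::ᵥ IH ::ᵥ v.tail) with hF
  -- `q` lowers the recursion argument, and `w` collects the arguments of `g`: the lowered argument,
  -- the recursive value and the parameters. Truncated subtraction at zero is harmless, because the
  -- recursive equation is imposed only when the first entry is nonzero.
  let q : ListFun := fun x => (x.getD 0 0 - 1) :: x.tail
  let w : ListFun := fun x => (x.getD 0 0 - 1) :: F (toVec (n + 1) (q x)) :: x.tail
  refine ⟨T ++ (U ++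
    ((List.finRange n).map (fun i : Fin n => eqClause [List.tail, entry i] [entry (i + 1)]) ++
    ((List.finRange n).map (fun i : Fin n => eqClause [q, entry (i + 1)] [entry (i + 1)]) ++
    ((List.finRange n).map (fun i : Fin n => eqClause [w, entry (i + 1 + 1)] [entry (i + 1)]) ++
    [eqClause [q, entry 0] [entry 0, predFun], eqClause [w, entry 0] [entry 0, predFun],
      eqClause [w, entry 1] [q, liftFun F],
      condEqClause ([entry 0], .zero) [List.tail, liftFun f] [liftFun F],
      condEqClause ([entry 0], .nonzero) [w, liftFun g] [liftFun F]])))), ?_, ?_⟩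
  · simp only [avoids_append, avoids_map, avoids_cons, avoids_nil,
      not_holds_eqClause, not_holds_condEqClause_zero, not_holds_condEqClause_nonzero, and_true,
      pathEnd_cons, pathEnd_nil, id]
    refine ⟨hT, hU, ?_, ?_, ?_, ?_, ?_, ?_, ?_, ?_⟩
    · simp [entry]
    · simp [entry, q]
    · simp [entry, w]
    · simp [entry, q, predFun]
    · simp [entry, w, predFun]
    · simp [entry, w, liftFun]
    · intro x hx
      have hx : x.getD 0 0 = 0 := hx
      simp only [liftFun, hF, toVec_succ, hx, List.Vector.head_cons, List.Vector.tail_cons]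
      rfl
    · intro x hx
      have hx : x.getD 0 0 ≠ 0 := hx
      obtain ⟨k, hk⟩ := Nat.exists_eq_succ_of_ne_zero hx
      simp only [liftFun, w, q, hF, toVec_succ, hk, List.Vector.head_cons, List.Vector.tail_cons,
        List.getD_cons_zero, List.tail_cons, Nat.succ_sub_one]
  · intro W ι Z H
    simp only [avoids_append, avoids_map, avoids_cons, avoids_nil,
      not_holds_eqClause, not_holds_condEqClause_zero, not_holds_condEqClause_nonzero, and_true,
      pathEnd_cons, pathEnd_nil, List.mem_finRange, forall_const] at H
    obtain ⟨H1, H2, Htail, Hq, Hw, Hq0, Hw0, Hw1, Hz, Hs⟩ := H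
    intro v
    obtain ⟨k, v, rfl⟩ := List.Vector.exists_eq_cons v
    -- The point varies in the induction: the hypothesis for `k` is applied at `ι q x`, which
    -- represents the lowered vector.
    induction k with
    | zero =>
      intro x hx
      rw [repVec_cons] at hx
      rw [← Hz x hx.1]
      simp only [hF, List.Vector.head_cons, List.Vector.tail_cons]
      apply hTf W ι Z H1
      intro i
      rw [Htail]
      exact hx.2 i
    | succ k ih =>
      intro x hx
      rw [repVec_cons] at hx
      have hFk : F (k.succ ::ᵥ v) = g (k ::ᵥ F (k ::ᵥ v) ::ᵥ v) := by
        simp only [hF, List.Vector.head_cons, List.Vector.tail_cons]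
      rw [← Hs x hx.1.1, hFk]
      apply hUg W ι Z H2
      rw [repVec_cons, Hw0]
      refine ⟨hx.1.2, fun i => ?_⟩
      refine Fin.cases ?_ (fun j => ?_) i
      · have h1 : ι (entry 1) (ι w x) = ι (liftFun F) (ι q x) := Hw1 x
        simp only [List.Vector.get_cons_zero, Fin.val_zero, zero_add, h1]
        apply ih
        rw [repVec_cons, Hq0]
        exact ⟨hx.1.2, fun i => by rw [Hq]; exact hx.2 i⟩
      · simp only [List.Vector.get_cons_succ, Fin.val_succ, Hw]
        exact hx.2 j

theorem captured_of_primrec' {n : ℕ} {f : List.Vector ℕ n → ℕ} (hf : Nat.Primrec' f) :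
    Captured f := by
  induction hf with
  | zero => exact captured_zero
  | succ => exact captured_succ
  | get i => exact captured_get i
  | comp g _ _ hf hg => exact captured_comp hf hg
  | prec _ _ hf hg => exact captured_prec hf hg

/-- Increments the first entry and keeps the others. -/
def stepFun : ListFun := fun x => (x.getD 0 0 + 1) :: x.tail

/-- The clauses that govern `stepFun`. -/
def stepClauses : List (Clause ListFun) :=
  [eqClause [stepFun, entry 0, predFun] [entry 0], [([stepFun, entry 0], .zero)],
    eqClause [stepFun, entry 1] [entry 1]]

theorem avoids_stepClauses : Avoids id zeroLists stepClauses := by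
  simp only [stepClauses, avoids_cons, avoids_nil, not_holds_zero, not_holds_eqClause, and_true]
  simp [pathEnd, stepFun, zeroLists, predFun, entry]

theorem repVec_stepFun {W : Type} {ι : ListFun → W → W} {Z : Set W} (h : Avoids ι Z stepClauses)
    {k n : ℕ} {x : W} (hx : RepVec ι Z (k ::ᵥ n ::ᵥ List.Vector.nil) x) :
    RepVec ι Z ((k + 1) ::ᵥ n ::ᵥ List.Vector.nil) (ι stepFun x) := by
  simp only [stepClauses, avoids_cons, avoids_nil, not_holds_zero, not_holds_eqClause, and_true,
    pathEnd_cons, pathEnd_nil] at h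
  obtain ⟨h1, h2, h3⟩ := h
  rw [repVec_cons] at hx ⊢
  refine ⟨⟨h2 x, by rw [h1]; exact hx.1⟩, fun i => ?_⟩
  have hi : i = 0 := Subsingleton.elim _ _
  subst hi
  have h3 : ι (entry 1) (ι stepFun x) = ι (entry 1) x := h3 x
  have := hx.2 0
  simpa [h3] using this

/-! ## Least closed assignments -/

theorem eval_mono {G : DataGraph} {X Y S : Assignment} (h : X ⊆ Y) (φ : ShapeExpr) :
    eval G X S φ ⊆ eval G Y S φ := by
  induction φ with
  | shape s => exact fun a ha => h ha
  | nominal a => exact subset_rfl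
  | concept A => exact subset_rfl
  | negShape s => exact subset_rfl
  | and φ ψ h₁ h₂ => exact Set.inter_subset_inter h₁ h₂
  | or φ ψ h₁ h₂ => exact Set.union_subset_union h₁ h₂
  | all r φ ih => exact fun a ha => ⟨ha.1, fun b hb hr => ih (ha.2 b hb hr)⟩
  | ex r φ ih => exact fun a ⟨b, hr, hb⟩ => ⟨b, hr, ih hb⟩

theorem exists_isLeast_closedUnderReduct (G : DataGraph) (C : Constraints) (N : Assignment) :
    ∃ S, IsLeast {X : Assignment | ClosedUnderReduct G C N X} S := by
  refine ⟨⋂₀ {X : Assignment | ClosedUnderReduct G C N X}, ?_,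
    fun X hX => Set.sInter_subset_of_mem hX⟩
  intro c hc a ha X hX
  exact hX c hc a (eval_mono (Set.sInter_subset_of_mem hX) _ ha)

/-- Every atom of a least closed assignment is supported by a constraint. -/
theorem mem_iff_of_isLeast {G : DataGraph} {C : Constraints} {N S : Assignment}
    (h : IsLeast {X : Assignment | ClosedUnderReduct G C N X} S) {s : ShapeName} {a : Individual} :
    (s, a) ∈ S ↔ ∃ φ, (s, φ) ∈ C ∧ a ∈ eval G S N φ := by
  refine ⟨fun hs => ?_, fun ⟨φ, hφ, ha⟩ => h.1 _ hφ a ha⟩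
  let T : Assignment := {p | p ∈ S ∧ ∃ φ, (p.1, φ) ∈ C ∧ p.2 ∈ eval G S N φ}
  have hT : ClosedUnderReduct G C N T := fun c hc a ha =>
    have ha' := eval_mono (fun p hp => hp.1 : T ⊆ S) _ ha
    ⟨h.1 c hc a ha', c.2, hc, ha'⟩
  exact (h.2 hT hs).2

/-- The value of the expression does not depend on the assignment for negated shape names. -/
def NegationFree (φ : ShapeExpr) : Prop :=
  ∀ (G : DataGraph) (X S S' : Assignment), eval G X S φ = eval G X S' φ

theorem NegationFree.and {φ ψ : ShapeExpr} (h₁ : NegationFree φ) (h₂ : NegationFree ψ) :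
    NegationFree (.and φ ψ) := fun G X S S' => by
  simp only [eval, h₁ G X S S', h₂ G X S S']

theorem NegationFree.or {φ ψ : ShapeExpr} (h₁ : NegationFree φ) (h₂ : NegationFree ψ) :
    NegationFree (.or φ ψ) := fun G X S S' => by
  simp only [eval, h₁ G X S S', h₂ G X S S']

theorem NegationFree.all {r : Role} {φ : ShapeExpr} (h : NegationFree φ) :
    NegationFree (.all r φ) := fun G X S S' => by
  simp only [eval, h G X S S']

theorem NegationFree.ex {r : Role} {φ : ShapeExpr} (h : NegationFree φ) :
    NegationFree (.ex r φ) := fun G X S S' => by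
  simp only [eval, h G X S S']

theorem negationFree_shape (s : ShapeName) : NegationFree (.shape s) := fun _ _ _ _ => rfl

theorem negationFree_concept (A : ConceptName) : NegationFree (.concept A) := fun _ _ _ _ => rfl

/-! ## Constraints that search for a clause that holds

The shape names `0` and `1` choose a set and its complement, `2` and `3` are the zeros and their
complement, `4` says that a clause holds or a successor is missing somewhere, `5` searches for a
zero along a chain, and `6` is the goal. The shape name `7` has no constraint. -/

/-- The shape name for a label. -/
def Label.toShape : Label → ShapeName
  | .mem => 0
  | .notMem => 1
  | .zero => 2
  | .nonzero => 3

/-- A disjunction. -/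
def disj (l : List ShapeExpr) : ShapeExpr := l.foldr .or (.shape 7)

theorem mem_eval_disj {G : DataGraph} {X S : Assignment} {l : List ShapeExpr} {a : Individual} :
    a ∈ eval G X S (disj l) ↔ (∃ φ ∈ l, a ∈ eval G X S φ) ∨ (7, a) ∈ X := by
  induction l with
  | nil => simp [disj, eval]
  | cons φ l ih =>
    change a ∈ eval G X S φ ∪ eval G X S (disj l) ↔ _
    rw [Set.mem_union, ih]
    simp [or_assoc]

theorem negationFree_disj {l : List ShapeExpr} (h : ∀ φ ∈ l, NegationFree φ) :
    NegationFree (disj l) := by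
  induction l with
  | nil => exact negationFree_shape 7
  | cons φ l ih =>
    exact (h φ (by simp)).or (ih fun ψ hψ => h ψ (List.mem_cons_of_mem _ hψ))

section Symbols

variable {σ : Type} (nm : σ → RoleName)

/-- The shape name `s` holds at the end of a path. -/
def pathExpr (p : List σ) (s : ShapeName) : ShapeExpr :=
  p.foldr (fun f φ => .ex (.name (nm f)) φ) (.shape s)

theorem negationFree_pathExpr (p : List σ) (s : ShapeName) : NegationFree (pathExpr nm p s) := by
  induction p with
  | nil => exact negationFree_shape s
  | cons f p ih => exact ih.ex

/-- The shape expression for a clause. -/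
def clauseExpr (c : Clause σ) : ShapeExpr :=
  c.foldr (fun l φ => .and (pathExpr nm l.1 l.2.toShape) φ) (.concept topConcept)

theorem negationFree_clauseExpr (c : Clause σ) : NegationFree (clauseExpr nm c) := by
  induction c with
  | nil => exact negationFree_concept _
  | cons l c ih => exact (negationFree_pathExpr nm _ _).and ih

theorem mem_eval_clauseExpr {G : DataGraph} {X S : Assignment} {c : Clause σ} {a : Individual} :
    a ∈ eval G X S (clauseExpr nm c) ↔
      (∀ l ∈ c, a ∈ eval G X S (pathExpr nm l.1 l.2.toShape)) ∧
        a ∈ eval G X S (.concept topConcept) := by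
  induction c with
  | nil => simp [clauseExpr]
  | cons l c ih =>
    change a ∈ eval G X S (pathExpr nm l.1 l.2.toShape) ∩ eval G X S (clauseExpr nm c) ↔ _
    rw [Set.mem_inter_iff, ih]
    simp [and_assoc]

/-- A clause of `T` holds, or a successor is missing, or a successor has shape `4`. -/
def faultExpr (L : List σ) (T : List (Clause σ)) : ShapeExpr :=
  disj (T.map (clauseExpr nm) ++ (L.map (fun f => .all (.name (nm f)) (.shape 7)) ++
    L.map (fun f => .ex (.name (nm f)) (.shape 4))))

theorem negationFree_faultExpr (L : List σ) (T : List (Clause σ)) :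
    NegationFree (faultExpr nm L T) := by
  apply negationFree_disj
  simp only [List.mem_append, List.mem_map]
  rintro φ (⟨c, _, rfl⟩ | ⟨f, _, rfl⟩ | ⟨f, _, rfl⟩)
  · exact negationFree_clauseExpr nm c
  · exact (negationFree_shape 7).all
  · exact (negationFree_shape 4).ex

/-- The constraints for the shape names other than the goal. -/
def searchConstraints (L : List σ) (T : List (Clause σ)) (test step : σ) : Constraints :=
  [(0, .negShape 1), (1, .negShape 0), (2, .concept 1), (3, .negShape 2), (4, faultExpr nm L T),
    (5, .or (.ex (.name (nm test)) (.shape 2)) (.ex (.name (nm step)) (.shape 5)))]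

/-- All constraints, where `init` describes the points that are not an initial point. -/
def goalConstraints (L : List σ) (T : List (Clause σ)) (test step : σ) (init : ShapeExpr) :
    Constraints :=
  (6, .or (.shape 4) (.or (.shape 5) init)) :: searchConstraints nm L T test step

theorem uniqueHeads_goalConstraints (L : List σ) (T : List (Clause σ)) (test step : σ)
    (init : ShapeExpr) : (goalConstraints nm L T test step init).UniqueHeads := by
  simp [Constraints.UniqueHeads, goalConstraints, searchConstraints]

variable {nm} {L : List σ} {T : List (Clause σ)} {test step : σ} {init : ShapeExpr}
  {G : DataGraph} {N S : Assignment}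

/-! ### Supports of the shape atoms -/

section Support

variable (h : IsLeast {X : Assignment |
  ClosedUnderReduct G (goalConstraints nm L T test step init) N X} S)
include h

theorem mem_zero_iff {a : Individual} : (0, a) ∈ S ↔ a ∈ G.nodes ∧ (1, a) ∉ N := by
  rw [mem_iff_of_isLeast h]
  simp [goalConstraints, searchConstraints, eval]

theorem mem_one_iff {a : Individual} : (1, a) ∈ S ↔ a ∈ G.nodes ∧ (0, a) ∉ N := by
  rw [mem_iff_of_isLeast h]
  simp [goalConstraints, searchConstraints, eval]

theorem mem_two_iff {a : Individual} : (2, a) ∈ S ↔ a ∈ G.conceptExt 1 := by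
  rw [mem_iff_of_isLeast h]
  simp [goalConstraints, searchConstraints, eval]

theorem mem_three_iff {a : Individual} : (3, a) ∈ S ↔ a ∈ G.nodes ∧ (2, a) ∉ N := by
  rw [mem_iff_of_isLeast h]
  simp [goalConstraints, searchConstraints, eval]

theorem mem_four_iff {a : Individual} : (4, a) ∈ S ↔ a ∈ eval G S N (faultExpr nm L T) := by
  rw [mem_iff_of_isLeast h]
  simp [goalConstraints, searchConstraints]

theorem mem_five_iff {a : Individual} : (5, a) ∈ S ↔
    a ∈ eval G S N (.or (.ex (.name (nm test)) (.shape 2)) (.ex (.name (nm step)) (.shape 5))) := by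
  rw [mem_iff_of_isLeast h]
  simp [goalConstraints, searchConstraints]

theorem mem_six_iff {a : Individual} : (6, a) ∈ S ↔
    (4, a) ∈ S ∨ (5, a) ∈ S ∨ a ∈ eval G S N init := by
  rw [mem_iff_of_isLeast h]
  simp [goalConstraints, searchConstraints, eval]

theorem not_mem_seven {a : Individual} : (7, a) ∉ S := by
  rw [mem_iff_of_isLeast h]
  simp [goalConstraints, searchConstraints]

end Support

end Symbols

/-! ### Stable models as choices of a set, and models from a refuted goal -/

section Symbols

variable {σ : Type} {nm : σ → RoleName} {L : List σ} {T : List (Clause σ)} {test step : σ}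
  {init : ShapeExpr} {G : DataGraph}

/-- Only the names `0`, `1` and `2` occur negated. The least assignment closed under the reduct for
a guess of these agrees with the guess on all nodes, so its own reduct is the same and it is stable.
-/
theorem exists_stable (hinit : NegationFree init) (G : DataGraph) (X : Set Individual) :
    ∃ S ∈ stableSemantics G (goalConstraints nm L T test step init), ∀ a ∈ G.nodes,
      ((0, a) ∈ S ↔ a ∈ X) ∧ ((1, a) ∈ S ↔ a ∉ X) := by
  -- The guess may also contain atoms outside the graph, where `S` does not follow it. Negated names
  -- are evaluated only at nodes, so this has no effect.
  let N : Assignment := {p | p.1 = 0 ∧ p.2 ∈ X ∨ p.1 = 1 ∧ p.2 ∉ X ∨ p.1 = 2 ∧ p.2 ∈ G.conceptExt 1}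
  obtain ⟨S, hS⟩ := exists_isLeast_closedUnderReduct G (goalConstraints nm L T test step init) N
  have h0 : ∀ a ∈ G.nodes, ((0, a) ∈ S ↔ a ∈ X) := fun a ha => by
    simp [mem_zero_iff hS, ha, N]
  have h1 : ∀ a ∈ G.nodes, ((1, a) ∈ S ↔ a ∉ X) := fun a ha => by
    simp [mem_one_iff hS, ha, N]
  refine ⟨S, ?_, fun a ha => ⟨h0 a ha, h1 a ha⟩⟩
  have heval : ∀ c ∈ goalConstraints nm L T test step init, ∀ Y,
      eval G Y S c.2 = eval G Y N c.2 := by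
    intro c hc Y
    simp only [goalConstraints, searchConstraints, List.mem_cons, List.not_mem_nil, or_false] at hc
    rcases hc with rfl | rfl | rfl | rfl | rfl | rfl | rfl
    · exact ((negationFree_shape 4).or ((negationFree_shape 5).or hinit)) G Y S N
    · ext a
      simp only [eval, Set.mem_ofPred_eq]
      exact and_congr_right fun ha => by rw [h1 a ha]; simp [N]
    · ext a
      simp only [eval, Set.mem_ofPred_eq]
      exact and_congr_right fun ha => by rw [h0 a ha]; simp [N]
    · rfl
    · ext a
      simp only [eval, Set.mem_ofPred_eq]
      exact and_congr_right fun ha => by rw [mem_two_iff hS]; simp [N]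
    · exact negationFree_faultExpr nm L T G Y S N
    · rfl
  have : {X : Assignment | ClosedUnderReduct G (goalConstraints nm L T test step init) S X} =
      {X : Assignment | ClosedUnderReduct G (goalConstraints nm L T test step init) N X} := by
    ext Y
    simp only [ClosedUnderReduct, Set.mem_ofPred_eq]
    exact forall₂_congr fun c hc => by rw [heval c hc Y]
  change IsLeast _ S
  rw [this]
  exact hS

/-- Only this direction holds: roles need not be functional, and `ι` follows one chosen successor
among possibly many. -/
theorem mem_eval_pathExpr {W : Type} {ι : σ → W → W} {v : W → Individual} {X S : Assignment}
    (hι : ∀ f ∈ L, ∀ x, Atom.role (nm f) (v x) (v (ι f x)) ∈ G) {p : List σ} (hp : ∀ f ∈ p, f ∈ L)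
    {s : ShapeName} {x : W} (hs : (s, v (pathEnd ι p x)) ∈ X) :
    v x ∈ eval G X S (pathExpr nm p s) := by
  induction p generalizing x with
  | nil => exact hs
  | cons f p ih =>
    exact ⟨v (ι f x), hι f (hp f (by simp)) x, ih (fun g hg => hp g (List.mem_cons_of_mem _ hg)) hs⟩

/-- If no stable model makes the goal true, then the points that can be reached carry total
functions that avoid the clauses, and the search finds no zero. -/
theorem exists_model_of_not_goal (hinit : NegationFree init)
    (hT : ∀ c ∈ T, ∀ l ∈ c, ∀ f ∈ l.1, f ∈ L)
    (htest : test ∈ L) (hstep : step ∈ L) {a : Individual} (ha : a ∈ G.nodes)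
    (h : ∀ S ∈ stableSemantics G (goalConstraints nm L T test step init), (6, a) ∉ S) :
    ∃ (W : Type) (ι : σ → W → W) (v : W → Individual) (w : W), v w = a ∧
      (∀ x, v x ∈ G.nodes) ∧
      (∀ f ∈ L, ∀ x, Atom.role (nm f) (v x) (v (ι f x)) ∈ G) ∧
      Avoids ι {x | v x ∈ G.conceptExt 1} T ∧
      ∀ k, v (ι test ((ι step)^[k] w)) ∉ G.conceptExt 1 := by
  let E : Individual → Individual → Prop := fun x y => ∃ f ∈ L, Atom.role (nm f) x y ∈ G
  -- Shape `4` propagates backwards along the roles of `L`, so refuting the goal at `a` excludes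
  -- faults at exactly the points that this set collects.
  let W := {x // Relation.ReflTransGen E a x}
  have hnodes : ∀ x : W, x.1 ∈ G.nodes := by
    rintro ⟨x, hx⟩
    rcases hx.cases_tail with rfl | ⟨y, _, f, _, hy⟩
    · exact ha
    · exact Or.inr (Or.inr ⟨_, _, hy⟩)
  have hfault : ∀ S ∈ stableSemantics G (goalConstraints nm L T test step init), ∀ x : W,
      x.1 ∉ eval G S S (faultExpr nm L T) := by
    rintro S hS ⟨x, hx⟩
    rw [← mem_four_iff hS]
    induction hx with
    | refl => exact fun h4 => h S hS ((mem_six_iff hS).2 (Or.inl h4))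
    | tail _ hxy ih =>
      obtain ⟨f, hf, hr⟩ := hxy
      intro h4
      refine ih ((mem_four_iff hS).2 (mem_eval_disj.2 (Or.inl ⟨.ex (.name (nm f)) (.shape 4), ?_,
        ⟨_, hr, h4⟩⟩)))
      exact List.mem_append_right _ (List.mem_append_right _ (List.mem_map.2 ⟨f, hf, rfl⟩))
  obtain ⟨S₀, hS₀, -⟩ := exists_stable (nm := nm) (L := L) (T := T) (test := test) (step := step)
    hinit G ∅
  -- A point without an `f`-successor would satisfy `∀f.7` vacuously, which is a fault. For symbols
  -- outside `L` the value is arbitrary.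
  have htotal : ∀ (f : σ) (x : W), ∃ y : W, f ∈ L → Atom.role (nm f) x.1 y.1 ∈ G := by
    intro f x
    by_cases hf : f ∈ L
    · by_contra! hc
      refine hfault S₀ hS₀ x (mem_eval_disj.2 (Or.inl ⟨.all (.name (nm f)) (.shape 7), ?_,
        hnodes x, fun b _ hb => ?_⟩))
      · exact List.mem_append_right _ (List.mem_append_left _ (List.mem_map.2 ⟨f, hf, rfl⟩))
      · exact absurd hb (hc ⟨b, x.2.tail ⟨f, hf, hb⟩⟩).2
    · exact ⟨x, fun h => absurd h hf⟩
  choose ι hι using htotal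
  have hι' : ∀ f ∈ L, ∀ x : W, Atom.role (nm f) x.1 (ι f x).1 ∈ G := fun f hf x => hι f x hf
  refine ⟨W, ι, Subtype.val, ⟨a, .refl⟩, rfl, hnodes, hι', ?_, fun k => ?_⟩
  · intro c hc x X hX
    -- A set for which some clause holds is turned into a stable model that chooses this set, and
    -- there the clause is a fault.
    obtain ⟨S, hS, hSX⟩ := exists_stable (nm := nm) (L := L) (T := T) (test := test)
      (step := step) hinit G (Subtype.val '' X)
    refine hfault S hS x (mem_eval_disj.2 (Or.inl ⟨clauseExpr nm c,
      List.mem_append_left _ (List.mem_map.2 ⟨c, hc, rfl⟩),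
      (mem_eval_clauseExpr nm).2 ⟨fun l hl => ?_, Or.inr ⟨rfl, hnodes x⟩⟩⟩))
    refine mem_eval_pathExpr hι' (hT c hc l hl) ?_
    have hlX := hX l hl
    have hy := hSX _ (hnodes (pathEnd ι l.1 x))
    have hx := hnodes (pathEnd ι l.1 x)
    generalize pathEnd ι l.1 x = y at hlX hy hx
    have hyX : y.1 ∈ Subtype.val '' X ↔ y ∈ X := Subtype.val_injective.mem_set_image
    rcases l with ⟨p, l⟩
    cases l with
    | mem => exact hy.1.2 (hyX.2 hlX)
    | notMem => exact hy.2.2 fun h => hlX (hyX.1 h)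
    | zero => exact (mem_two_iff hS).2 hlX
    | nonzero => exact (mem_three_iff hS).2 ⟨hx, fun h => hlX ((mem_two_iff hS).1 h)⟩
  · have h5 : (5, ((ι step)^[k] ⟨a, .refl⟩).1) ∉ S₀ := by
      induction k with
      | zero => exact fun h5 => h S₀ hS₀ ((mem_six_iff hS₀).2 (Or.inr (Or.inl h5)))
      | succ k ih =>
        intro h5
        rw [Function.iterate_succ_apply'] at h5
        exact ih ((mem_five_iff hS₀).2 (Or.inr ⟨_, hι' step hstep _, h5⟩))
    intro hz
    exact h5 ((mem_five_iff hS₀).2 (Or.inl ⟨_, hι' test htest _, (mem_two_iff hS₀).2 hz⟩))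

end Symbols

/-! ## The initial point -/

/-- The point does not represent the number, where `p` is the role name of the predecessor. -/
def notNumeral (p : RoleName) : ℕ → ShapeExpr
  | 0 => .shape 3
  | n + 1 => .or (.shape 2) (.ex (.name p) (notNumeral p n))

/-- The point does not represent the vector `(0, n)`. -/
def initExpr (nm : ListFun → RoleName) (n : ℕ) : ShapeExpr :=
  .or (.ex (.name (nm (entry 0))) (.shape 3))
    (.ex (.name (nm (entry 1))) (notNumeral (nm predFun) n))

theorem negationFree_notNumeral (p : RoleName) (n : ℕ) : NegationFree (notNumeral p n) := by
  induction n with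
  | zero => exact negationFree_shape 3
  | succ n ih => exact (negationFree_shape 2).or ih.ex

theorem negationFree_initExpr (nm : ListFun → RoleName) (n : ℕ) : NegationFree (initExpr nm n) :=
  (negationFree_shape 3).ex.or (negationFree_notNumeral _ n).ex

section Halting

variable {nm : ListFun → RoleName} {L : List ListFun} {T : List (Clause ListFun)}

/-- Failure of `initExpr` constrains all successors along the entry and predecessor roles, in
particular those chosen by `ι`. -/
theorem repVec_of_not_initExpr {test step : ListFun} {init : ShapeExpr} {G : DataGraph}
    {S : Assignment} (hS : S ∈ stableSemantics G (goalConstraints nm L T test step init))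
    {W : Type} {ι : ListFun → W → W} {v : W → Individual} (hv : ∀ x, v x ∈ G.nodes)
    (hι : ∀ f ∈ L, ∀ x, Atom.role (nm f) (v x) (v (ι f x)) ∈ G)
    (h0 : entry 0 ∈ L) (h1 : entry 1 ∈ L) (hp : predFun ∈ L) {n : ℕ} {x : W}
    (h : v x ∉ eval G S S (initExpr nm n)) :
    RepVec ι {x | v x ∈ G.conceptExt 1} (0 ::ᵥ n ::ᵥ List.Vector.nil) x := by
  have hzero : ∀ y, (3, v y) ∉ S → v y ∈ G.conceptExt 1 := fun y hy => by
    by_contra hz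
    exact hy ((mem_three_iff hS).2 ⟨hv y, fun h2 => hz ((mem_two_iff hS).1 h2)⟩)
  have hnum : ∀ (k : ℕ) (y : W), v y ∉ eval G S S (notNumeral (nm predFun) k) →
      RepNat ι {x | v x ∈ G.conceptExt 1} k y := by
    intro k
    induction k with
    | zero => exact fun y hy => hzero y hy
    | succ k ih =>
      intro y hy
      refine ⟨fun hz => hy (Or.inl ((mem_two_iff hS).2 hz)), ih _ fun hk => ?_⟩
      exact hy (Or.inr ⟨_, hι _ hp y, hk⟩)
  rw [repVec_cons]
  refine ⟨hzero _ fun h3 => h (Or.inl ⟨_, hι _ h0 x, h3⟩), fun i => ?_⟩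
  obtain rfl : i = 0 := Subsingleton.elim _ _
  exact hnum n _ fun hn => h (Or.inr ⟨_, hι _ h1 x, hn⟩)

/-! ## The standard graph -/

/-- The data graph of the standard interpretation of the symbols in `L`. -/
def standardGraph (nm : ListFun → RoleName) (L : List ListFun) : DataGraph :=
  {t | (∃ x ∈ zeroLists, t = .concept 1 (Encodable.encode x)) ∨
    ∃ f ∈ L, ∃ x, t = .role (nm f) (Encodable.encode x) (Encodable.encode (f x))}

theorem exists_encode_eq (a : Individual) : ∃ x : List ℕ, Encodable.encode x = a :=
  ⟨Denumerable.ofNat (List ℕ) a, Denumerable.encode_ofNat a⟩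

/-- Injectivity of the role naming on `L` keeps the graphs of different functions apart, so every
role is functional. -/
theorem role_mem_standardGraph (hnm : Set.InjOn nm {f | f ∈ L}) {f : ListFun} (hf : f ∈ L)
    {x y : List ℕ} : Atom.role (nm f) (Encodable.encode x) (Encodable.encode y) ∈
      standardGraph nm L ↔ y = f x := by
  constructor
  · rintro (⟨z, _, h⟩ | ⟨g, hg, z, h⟩)
    · cases h
    · injection h with h1 h2 h3
      have h1 := hnm hf hg h1
      have h2 := Encodable.encode_injective h2
      have h3 := Encodable.encode_injective h3
      rw [h3, h1, h2]
  · rintro rfl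
    exact Or.inr ⟨f, hf, x, rfl⟩

theorem mem_conceptExt_standardGraph {x : List ℕ} :
    Encodable.encode x ∈ (standardGraph nm L).conceptExt 1 ↔ x ∈ zeroLists := by
  constructor
  · rintro ((⟨z, hz, h⟩ | ⟨f, _, z, h⟩) | ⟨h, _⟩)
    · injection h with _ h
      exact Encodable.encode_injective h ▸ hz
    · exact Atom.noConfusion h
    · exact absurd h one_ne_zero
  · exact fun h => Or.inl (Or.inl ⟨x, h, rfl⟩)

theorem mem_nodes_standardGraph {f : ListFun} (hf : f ∈ L) (a : Individual) :
    a ∈ (standardGraph nm L).nodes := by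
  obtain ⟨x, rfl⟩ := exists_encode_eq a
  exact Or.inr (Or.inl ⟨_, _, Or.inr ⟨f, hf, x, rfl⟩⟩)

theorem mem_eval_ex_standardGraph (hnm : Set.InjOn nm {f | f ∈ L}) {f : ListFun} (hf : f ∈ L)
    {X S : Assignment} {φ : ShapeExpr} {x : List ℕ} :
    Encodable.encode x ∈ eval (standardGraph nm L) X S (.ex (.name (nm f)) φ) ↔
      Encodable.encode (f x) ∈ eval (standardGraph nm L) X S φ := by
  constructor
  · rintro ⟨b, hb, h⟩
    obtain ⟨y, rfl⟩ := exists_encode_eq b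
    rwa [(role_mem_standardGraph hnm hf).1 hb] at h
  · exact fun h => ⟨_, (role_mem_standardGraph hnm hf).2 rfl, h⟩

theorem mem_eval_pathExpr_standardGraph (hnm : Set.InjOn nm {f | f ∈ L}) {p : List ListFun}
    (hp : ∀ f ∈ p, f ∈ L) {X S : Assignment} {s : ShapeName} {x : List ℕ} :
    Encodable.encode x ∈ eval (standardGraph nm L) X S (pathExpr nm p s) ↔
      (s, Encodable.encode (pathEnd id p x)) ∈ X := by
  induction p generalizing x with
  | nil => rfl
  | cons f p ih =>
    exact (mem_eval_ex_standardGraph hnm (hp f (by simp))).trans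
      (ih fun g hg => hp g (List.mem_cons_of_mem _ hg))

/-- Atoms that are not derived from the others are not in a least closed assignment. -/
theorem not_mem_of_isLeast {G : DataGraph} {C : Constraints} {N S P : Assignment}
    (h : IsLeast {X : Assignment | ClosedUnderReduct G C N X} S)
    (hP : ∀ c ∈ C, ∀ a ∈ eval G (S \ P) N c.2, (c.1, a) ∉ P) {p : ShapeAtom} (hp : p ∈ P) :
    p ∉ S := by
  have : ClosedUnderReduct G C N (S \ P) := fun c hc a ha =>
    ⟨h.1 c hc a (eval_mono Set.sdiff_subset _ ha), hP c hc a ha⟩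
  exact fun hs => (h.2 this hs).2 hp

theorem not_goal_standardGraph (hnm : Set.InjOn nm {f | f ∈ L})
    (hT : ∀ c ∈ T, ∀ l ∈ c, ∀ f ∈ l.1, f ∈ L) (hav : Avoids id zeroLists T) {test step : ListFun}
    (htest : test ∈ L) (hstep : step ∈ L) {init : ShapeExpr} {x : List ℕ}
    (hsearch : ∀ k, test (step^[k] x) ∉ zeroLists) {S : Assignment}
    (hS : S ∈ stableSemantics (standardGraph nm L) (goalConstraints nm L T test step init))
    (hinit : Encodable.encode x ∉ eval (standardGraph nm L) S S init) :
    (6, Encodable.encode x) ∉ S := by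
  have hmem : ∀ c ∈ goalConstraints nm L T test step init, c.1 = 4 → c.2 = faultExpr nm L T := by
    simp [goalConstraints, searchConstraints]
  have hmem' : ∀ c ∈ goalConstraints nm L T test step init, c.1 = 5 →
      c.2 = .or (.ex (.name (nm test)) (.shape 2)) (.ex (.name (nm step)) (.shape 5)) := by
    simp [goalConstraints, searchConstraints]
  -- The atoms of shape `4` are unfounded: clauses fail and successors exist, so each atom could be
  -- derived only from another one.
  have h4 : ∀ b, (4, b) ∉ S := by
    intro b
    refine not_mem_of_isLeast hS (P := {p | p.1 = 4}) ?_ rfl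
    intro c hc b hb hc4
    rw [hmem c hc hc4] at hb
    obtain ⟨y, rfl⟩ := exists_encode_eq b
    rcases mem_eval_disj.1 hb with ⟨φ, hφ, hb⟩ | h7
    · simp only [List.mem_append, List.mem_map] at hφ
      rcases hφ with ⟨d, hd, rfl⟩ | ⟨f, hf, rfl⟩ | ⟨f, hf, rfl⟩
      -- The set variable takes the value chosen by the stable model through shape `0`.
      · refine hav d hd y {z | (0, Encodable.encode z) ∈ S} fun l hl => ?_
        have hb := ((mem_eval_clauseExpr nm).1 hb).1 l hl
        have hb := ((mem_eval_pathExpr_standardGraph hnm (hT d hd l hl)).1 hb).1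
        rcases l with ⟨p, l⟩
        cases l with
        | mem => exact hb
        | notMem => exact ((mem_one_iff hS).1 hb).2
        | zero => exact mem_conceptExt_standardGraph.1 ((mem_two_iff hS).1 hb)
        | nonzero =>
          exact fun hz => ((mem_three_iff hS).1 hb).2
            ((mem_two_iff hS).2 (mem_conceptExt_standardGraph.2 hz))
      · have := hb.2 _ (mem_nodes_standardGraph htest _) ((role_mem_standardGraph hnm hf).2 rfl)
        exact not_mem_seven hS this.1
      · have := (mem_eval_ex_standardGraph hnm hf).1 hb
        exact this.2 rfl
    · exact not_mem_seven hS h7.1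
  have h5 : (5, Encodable.encode x) ∉ S := by
    -- Only the orbit of `x` under `step` is removed; the search may succeed from other points.
    refine not_mem_of_isLeast hS (P := {p | p.1 = 5 ∧ ∃ k, p.2 = Encodable.encode (step^[k] x)})
      ?_ ⟨rfl, 0, rfl⟩
    rintro c hc b hb ⟨hc5, k, hk⟩
    rw [hmem' c hc hc5] at hb
    simp only at hk
    subst hk
    rcases hb with hb | hb
    · have := ((mem_eval_ex_standardGraph hnm htest).1 hb).1
      exact hsearch k (mem_conceptExt_standardGraph.1 ((mem_two_iff hS).1 this))
    · have := ((mem_eval_ex_standardGraph hnm hstep).1 hb).2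
      exact this ⟨rfl, k + 1, by rw [Function.iterate_succ_apply']⟩
  rw [mem_six_iff hS]
  simp [h4, h5, hinit]

theorem not_mem_initExpr_standardGraph (hnm : Set.InjOn nm {f | f ∈ L}) (h0 : entry 0 ∈ L)
    (h1 : entry 1 ∈ L) (hp : predFun ∈ L) {test step : ListFun} {init : ShapeExpr} {S : Assignment}
    (hS : S ∈ stableSemantics (standardGraph nm L) (goalConstraints nm L T test step init))
    (n : ℕ) :
    Encodable.encode [0, n] ∉ eval (standardGraph nm L) S S (initExpr nm n) := by
  have hzero : ∀ y : List ℕ, y ∈ zeroLists → (3, Encodable.encode y) ∉ S := fun y hy h3 =>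
    ((mem_three_iff hS).1 h3).2 ((mem_two_iff hS).2 (mem_conceptExt_standardGraph.2 hy))
  have hnum : ∀ k : ℕ, Encodable.encode [k] ∉
      eval (standardGraph nm L) S S (notNumeral (nm predFun) k) := by
    intro k
    induction k with
    | zero => exact hzero [0] rfl
    | succ k ih =>
      rintro (h | h)
      · exact absurd (mem_conceptExt_standardGraph.1 ((mem_two_iff hS).1 h)) (Nat.succ_ne_zero k)
      · exact ih ((mem_eval_ex_standardGraph hnm hp).1 h)
  rintro (h | h)
  · exact hzero [0] rfl ((mem_eval_ex_standardGraph hnm h0).1 h)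
  · exact hnum n ((mem_eval_ex_standardGraph hnm h1).1 h)

end Halting

/-! ## The reduction -/

theorem satisfies_nodeDocument {Sem : Semantics} {G : DataGraph} {C : Constraints} {s : ShapeName}
    {a : Individual} : Satisfies Sem G (nodeDocument C s a) ↔ ∃ S ∈ Sem G C, (s, a) ∈ S := by
  simp [Satisfies, nodeDocument, Validates]

/-- The constraint that makes the shape name `0` true at every node. -/
def trivialConstraints : Constraints := [(0, .concept topConcept)]

theorem satisfies_trivialConstraints {G : DataGraph} {a : Individual} (ha : a ∈ G.nodes) :
    Satisfies stableSemantics G (nodeDocument trivialConstraints 0 a) := by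
  rw [satisfies_nodeDocument]
  obtain ⟨S, hS⟩ := exists_isLeast_closedUnderReduct G trivialConstraints ∅
  have : {X : Assignment | ClosedUnderReduct G trivialConstraints S X} =
      {X : Assignment | ClosedUnderReduct G trivialConstraints ∅ X} := by
    simp [ClosedUnderReduct, trivialConstraints, eval]
  refine ⟨S, ?_, hS.1 _ (List.mem_singleton.2 rfl) a (Or.inr ⟨rfl, ha⟩)⟩
  change IsLeast _ S
  rw [this]
  exact hS

/-- Whether a search for a zero of a primitive recursive function succeeds is expressed by shape
implication. -/
theorem exists_shapeImplies_iff {F : List.Vector ℕ 2 → ℕ} (hF : Nat.Primrec' F) :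
    ∃ (nm : ListFun → RoleName) (L : List ListFun) (T : List (Clause ListFun)), ∀ n : ℕ,
      ShapeImplies stableSemantics trivialConstraints 0
        (goalConstraints nm L T (liftFun F) stepFun (initExpr nm n)) 6 ↔
      ∃ k, F (k ::ᵥ n ::ᵥ List.Vector.nil) = 0 := by
  classical
  obtain ⟨T₀, hT₀, hT₀F⟩ := captured_of_primrec' hF
  let T := T₀ ++ stepClauses
  -- All symbols of the clauses are included, and the position in `L` serves as the role name. None
  -- of this depends on `n`.
  let L : List ListFun := [liftFun F, stepFun, entry 0, entry 1, predFun] ++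
    T.flatMap fun c => c.flatMap fun l => l.1
  let nm : ListFun → RoleName := fun f => L.idxOf f
  have hnm : Set.InjOn nm {f | f ∈ L} := fun f hf g _ h => (List.idxOf_inj hf).1 h
  have hT : ∀ c ∈ T, ∀ l ∈ c, ∀ f ∈ l.1, f ∈ L := fun c hc l hl f hf =>
    List.mem_append_right _ (List.mem_flatMap.2 ⟨c, hc, List.mem_flatMap.2 ⟨l, hl, hf⟩⟩)
  have htest : liftFun F ∈ L := by simp [L]
  have hstep : stepFun ∈ L := by simp [L]
  have h0 : entry 0 ∈ L := by simp [L]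
  have h1 : entry 1 ∈ L := by simp [L]
  have hp : predFun ∈ L := by simp [L]
  refine ⟨nm, L, T, fun n => ⟨fun h => ?_, fun ⟨k, hk⟩ => ?_⟩⟩
  · by_contra! hk
    have hn := mem_nodes_standardGraph (nm := nm) htest
    obtain ⟨S, hS, h6⟩ := satisfies_nodeDocument.1 (h (standardGraph nm L)
      (Encodable.encode [0, n]) (hn _) (fun a _ => hn a) (fun a _ => hn a)
      (satisfies_trivialConstraints (hn _)))
    refine not_goal_standardGraph hnm hT (avoids_append.2 ⟨hT₀, avoids_stepClauses⟩) htest hstep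
      (fun k => ?_) hS (not_mem_initExpr_standardGraph hnm h0 h1 hp hS n) h6
    have hiter : stepFun^[k] [0, n] = [k, n] := by
      induction k with
      | zero => rfl
      | succ k ih => rw [Function.iterate_succ_apply', ih]; rfl
    rw [hiter]
    exact hk k
  · intro G a ha _ _ _
    rw [satisfies_nodeDocument]
    by_contra! hc
    obtain ⟨W, ι, v, w, rfl, hv, hι, hav, hsearch⟩ :=
      exists_model_of_not_goal (negationFree_initExpr nm n) hT htest hstep ha hc
    obtain ⟨hav₀, hav₁⟩ := avoids_append.1 hav
    obtain ⟨S, hS, -⟩ := exists_stable (nm := nm) (L := L) (T := T) (test := liftFun F)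
      (step := stepFun) (negationFree_initExpr nm n) G ∅
    have hrep := repVec_of_not_initExpr hS hv hι h0 h1 hp
      fun hi => hc S hS ((mem_six_iff hS).2 (Or.inr (Or.inr hi)))
    have hreps : ∀ k, RepVec ι {x | v x ∈ G.conceptExt 1} (k ::ᵥ n ::ᵥ List.Vector.nil)
        ((ι stepFun)^[k] w) := by
      intro k
      induction k with
      | zero => exact hrep
      | succ k ih =>
        rw [Function.iterate_succ_apply']
        exact repVec_stepFun hav₁ ih
    -- The test value at the `k`-th point represents `F (k, n) = 0`, so it lies in the zero set that
    -- the search was shown to miss.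
    have := hT₀F W ι _ hav₀ _ _ (hreps k)
    rw [hk] at this
    exact hsearch k this

/-! ### Computability of the reduction -/

theorem primrec_or : Primrec₂ ShapeExpr.or := by
  refine Primrec.encode_iff.1 ?_
  have : Primrec fun p : ShapeExpr × ShapeExpr =>
      8 * Nat.pair (Encodable.encode p.1) (Encodable.encode p.2) + 5 :=
    Primrec.nat_add.comp (Primrec.nat_mul.comp (Primrec.const 8)
      (Primrec₂.natPair.comp (Primrec.encode.comp Primrec.fst) (Primrec.encode.comp Primrec.snd)))
      (Primrec.const 5)
  exact this

theorem primrec_ex (r : Role) : Primrec (ShapeExpr.ex r) := by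
  refine Primrec.encode_iff.1 ?_
  have : Primrec fun φ : ShapeExpr => 8 * Nat.pair r.toNat (Encodable.encode φ) + 7 :=
    Primrec.nat_add.comp (Primrec.nat_mul.comp (Primrec.const 8)
      (Primrec₂.natPair.comp (Primrec.const _) Primrec.encode)) (Primrec.const 7)
  exact this

theorem primrec_notNumeral (p : RoleName) : Primrec (notNumeral p) := by
  have : Primrec fun n : ℕ => (n.rec (.shape 3)
      fun _ φ => .or (.shape 2) (.ex (.name p) φ) : ShapeExpr) :=
    Primrec.nat_rec₁ _ (primrec_or.comp (Primrec.const _) ((primrec_ex _).comp Primrec.snd))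
  refine this.of_eq fun n => ?_
  induction n with
  | zero => rfl
  | succ n ih => simp only [notNumeral, ← ih]

theorem primrec_initExpr (nm : ListFun → RoleName) : Primrec (initExpr nm) :=
  primrec_or.comp (Primrec.const _) ((primrec_ex _).comp (primrec_notNumeral _))

/-- The input enters only through `initExpr`; the remaining constraints are a fixed constant, so the
nonconstructive choice of `nm`, `L` and `T` does not matter. -/
theorem primrec_goalConstraints (nm : ListFun → RoleName) (L : List ListFun)
    (T : List (Clause ListFun)) (test step : ListFun) :
    Primrec fun n => goalConstraints nm L T test step (initExpr nm n) :=
  Primrec.list_cons.comp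
    (Primrec.pair (Primrec.const _) (primrec_or.comp (Primrec.const _)
      (primrec_or.comp (Primrec.const _) (primrec_initExpr nm)))) (Primrec.const _)

/-- Zero if the program with code `n` halts on input `0` within `k` steps. -/
def haltTest (v : List.Vector ℕ 2) : ℕ :=
  if (Nat.Partrec.Code.evaln v.head (Denumerable.ofNat Nat.Partrec.Code v.tail.head) 0).isSome
  then 0 else 1

theorem primrec'_haltTest : Nat.Primrec' haltTest := by
  apply Nat.Primrec'.of_prim
  have h : Primrec fun v : List.Vector ℕ 2 =>
      Nat.Partrec.Code.evaln v.head (Denumerable.ofNat Nat.Partrec.Code v.tail.head) 0 :=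
    Nat.Partrec.Code.primrec_evaln.comp (Primrec.pair (Primrec.pair Primrec.vector_head
      ((Primrec.ofNat Nat.Partrec.Code).comp (Primrec.vector_head.comp Primrec.vector_tail)))
      (Primrec.const 0))
  exact Primrec.ite (Primrec.eq.comp (Primrec.option_isSome.comp h) (Primrec.const true))
    (Primrec.const 0) (Primrec.const 1)

/-- Step-bounded evaluation is complete: a computation halts iff it does so within some bound `k`.
-/
theorem exists_haltTest_iff (c : Nat.Partrec.Code) :
    (∃ k, haltTest (k ::ᵥ Encodable.encode c ::ᵥ List.Vector.nil) = 0) ↔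
      (Nat.Partrec.Code.eval c 0).Dom := by
  simp only [haltTest, List.Vector.head_cons, List.Vector.tail_cons, Denumerable.ofNat_encode,
    Part.dom_iff_mem, Nat.Partrec.Code.evaln_complete, ite_eq_left_iff, one_ne_zero, imp_false,
    not_not, Option.isSome_iff_exists, Option.mem_def]
  exact exists_comm

end SHACL

theorem mainTheorem3 :
    ¬ SHACL.ShapeImplicationDecidable SHACL.stableSemantics := by
  rintro ⟨decider, hcomp, hdec⟩
  obtain ⟨nm, L, T, h⟩ := SHACL.exists_shapeImplies_iff SHACL.primrec'_haltTest
  apply ComputablePred.halting_problem 0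
  refine ComputablePred.computable_iff.2 ⟨fun c => decider ((SHACL.trivialConstraints, 0),
    (SHACL.goalConstraints nm L T (SHACL.liftFun SHACL.haltTest) SHACL.stepFun
      (SHACL.initExpr nm (Encodable.encode c)), 6)), ?_, ?_⟩
  · refine hcomp.comp (Primrec.to_comp ?_)
    exact Primrec.pair (Primrec.const _) (Primrec.pair
      ((SHACL.primrec_goalConstraints nm L T _ _).comp Primrec.encode) (Primrec.const _))
  · funext c
    rw [hdec _ _ _ _ (by simp [SHACL.Constraints.UniqueHeads, SHACL.trivialConstraints])
      (SHACL.uniqueHeads_goalConstraints nm L T _ _ _), h, SHACL.exists_haltTest_iff]
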